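/- Let $d \ge 1$, and let $(\rho_n)_{n\in\mathbb N}$ be a sequence of radial mollifiers, i.e. $\rho_n \in L^1_{\mathrm{loc}}(0,+\infty)$, $\rho_n \ge 0$, $\int_0^\infty \rho_n(r)\, r^{d-1}\,dr = 1$ for all $n$, and $\lim_{n\to+\infty}\int_\delta^\infty \rho_n(r)\, r^{d-1}\,dr = 0$ for every $\delta>0$. Let $u \in L^1(\mathbb R^d)$ be real-valued. Then $u \in W^{1,1}(\mathbb R^d)$ if and only if there exists $U \in [L^1(\mathbb R^d)]^d$ such that $$\lim_{n\to+\infty} \int_{\mathbb R^d}\int_{\mathbb R^d} \frac{|u(x+h)-u(x)-U(x)\cdot h|}{|h|}\,\rho_n(|h|)\,dh\,dx = 0 ,$$ where $|\cdot|$ is the Euclidean norm and the double integral takes values in $[0,+\infty]$. Moreover, every $U \in [L^1(\mathbb R^d)]^d$ with this property is the weak gradient of $u$, i.e. $\nabla u = U$ almost everywhere. -/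

import Mathlib

open MeasureTheory Set Filter Topology
open scoped ENNReal ContDiff

/-- `ρ` is a sequence of radial mollifiers in dimension `d`: each `ρ n` is locally integrable on
`(0, ∞)` and nonnegative almost everywhere there, `∫₀^∞ ρ n r * r ^ (d - 1) dr = 1` for every `n`,
and `∫_δ^∞ ρ n r * r ^ (d - 1) dr → 0` as `n → ∞` for every `δ > 0`. -/
structure IsRadialMollifier (d : ℕ) (ρ : ℕ → ℝ → ℝ) : Prop where
  locallyIntegrableOn : ∀ n, LocallyIntegrableOn (ρ n) (Ioi 0) volume
  nonneg : ∀ n, ∀ᵐ r ∂(volume.restrict (Ioi (0 : ℝ))), 0 ≤ ρ n r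
  integral_eq_one : ∀ n, ∫ r in Ioi (0 : ℝ), ρ n r * r ^ (d - 1) = 1
  tendsto_tail : ∀ δ : ℝ, 0 < δ →
    Tendsto (fun n => ∫ r in Ioi δ, ρ n r * r ^ (d - 1)) atTop (𝓝 0)

/-- The vector field `V` is the weak (distributional) gradient of `u` on `ℝ^d`: both are locally
integrable and `∫ u ∂ᵢφ = - ∫ Vᵢ φ` for every test function `φ ∈ C_c^∞(ℝ^d)` and every `i`. -/
structure HasWeakGradient {d : ℕ} (u : EuclideanSpace ℝ (Fin d) → ℝ)
    (V : EuclideanSpace ℝ (Fin d) → EuclideanSpace ℝ (Fin d)) : Prop where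
  locallyIntegrable : LocallyIntegrable u volume
  locallyIntegrable_grad : LocallyIntegrable V volume
  integral_eq : ∀ φ : EuclideanSpace ℝ (Fin d) → ℝ, ContDiff ℝ ∞ φ → HasCompactSupport φ →
    ∀ i : Fin d, ∫ x, u x * fderiv ℝ φ x (EuclideanSpace.single i 1) = -∫ x, V x i * φ x

/-- The Sobolev space `W^{1,1}(ℝ^d)`: integrable functions with an integrable weak gradient. -/
def MemW11 {d : ℕ} (u : EuclideanSpace ℝ (Fin d) → ℝ) : Prop :=
  Integrable u volume ∧
    ∃ V : EuclideanSpace ℝ (Fin d) → EuclideanSpace ℝ (Fin d),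
      Integrable V volume ∧ HasWeakGradient u V

/-- The double integral `∫∫ |u(x + h) - u(x) - U(x) · h| / |h| * ρ(|h|) dh dx`, with values in
`[0, ∞]`. -/
noncomputable def taylorDefect {d : ℕ} (ρ : ℝ → ℝ) (u : EuclideanSpace ℝ (Fin d) → ℝ)
    (U : EuclideanSpace ℝ (Fin d) → EuclideanSpace ℝ (Fin d)) : ℝ≥0∞ :=
  ∫⁻ x : EuclideanSpace ℝ (Fin d), ∫⁻ h : EuclideanSpace ℝ (Fin d),
    ENNReal.ofReal (|u (x + h) - u x - inner ℝ (U x) h| / ‖h‖ * ρ ‖h‖)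

/-! Write `R_h(x) = u(x + h) - u(x) - U(x) · h`. By Tonelli the defect is the integral of `‖R_h‖₁ /
|h|` against `ρ_n(|h|) dh`, a kernel of fixed mass concentrating at `0`.

Small defect forces `∇u = U`: for a test function `φ` put `a = ∫ (u ∇φ + φ U)`. Moving the
translation onto `φ` gives `|a · h| ≤ A min(|h|, 1) |h| + B ‖R_h‖₁`
(`exists_enorm_inner_weakDefect_le`). After division by `|h|` and integration against the kernel,
the first term dies by concentration and the second is the defect. By rotation invariance the left
side dominates a fixed positive multiple of `|a|` (`enorm_mul_lintegral_radial_le`), so `a = 0`.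

Conversely, if `∇u = V`, the fundamental theorem of calculus along segments gives `‖R_h‖₁ ≤ |h| ∫₀¹
‖V(· + th) - V‖₁ dt` (`taylorRemainder_le`). The mean on the right is bounded and tends to `0` with
`h` by continuity of translations in `L¹`, so concentration applies again. -/

/-- A sequence of densities of common finite mass `σ` concentrating at the origin kills, in the
limit, the integral of any bounded function vanishing at the origin. -/
theorem tendsto_lintegral_mul_of_concentrating {E : Type*} [NormedAddCommGroup E]
    [MeasurableSpace E] [BorelSpace E] {μ : Measure E} {k : ℕ → E → ℝ≥0∞} {σ M : ℝ≥0∞}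
    (hk : ∀ n, AEMeasurable (k n) μ) (hσ : σ ≠ ⊤) (hM : M ≠ ⊤) (hmass : ∀ n, ∫⁻ h, k n h ∂μ = σ)
    (htail : ∀ δ : ℝ, 0 < δ →
      Tendsto (fun n => ∫⁻ h, {h | δ < ‖h‖}.indicator (k n) h ∂μ) atTop (𝓝 0))
    {G : E → ℝ≥0∞} (hG : ∀ h, G h ≤ M) (hG0 : Tendsto G (𝓝 0) (𝓝 0)) :
    Tendsto (fun n => ∫⁻ h, G h * k n h ∂μ) atTop (𝓝 0) := by
  have key : ∀ ε : ℝ≥0∞, 0 < ε → ∃ δ : ℝ, 0 < δ ∧ ∀ n, ∫⁻ h, G h * k n h ∂μ ≤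
      ε * σ + M * ∫⁻ h, {h | δ < ‖h‖}.indicator (k n) h ∂μ := by
    intro ε hε
    have h1 := (ENNReal.tendsto_nhds_zero.1 hG0) ε hε
    obtain ⟨δ, hδ, hb⟩ := Metric.eventually_nhds_iff.1 h1
    -- Halving makes the complement `‖h‖ ≤ δ / 2` of the tail lie in the open `δ`-ball.
    refine ⟨δ / 2, by positivity, fun n => ?_⟩
    have hmeas : MeasurableSet {h : E | δ / 2 < ‖h‖} :=
      measurableSet_lt measurable_const measurable_norm
    calc ∫⁻ h, G h * k n h ∂μ
        ≤ ∫⁻ h, (ε * k n h + M * {h | δ / 2 < ‖h‖}.indicator (k n) h) ∂μ := by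
          refine lintegral_mono fun h => ?_
          by_cases hh : δ / 2 < ‖h‖
          · rw [indicator_of_mem (by exact hh)]
            exact le_add_of_nonneg_of_le zero_le (mul_le_mul_left (hG h) _)
          · have : dist h 0 < δ := by rw [dist_zero_right]; linarith
            exact le_add_of_le_of_nonneg (mul_le_mul_left (hb this) _) zero_le
      _ = _ := by
          rw [lintegral_add_left' ((hk n).const_mul _), lintegral_const_mul'' _ (hk n),
            lintegral_const_mul'' _ ((hk n).indicator hmeas), hmass]
  rw [ENNReal.tendsto_nhds_zero]
  intro ε hε
  obtain ⟨η, hη, hησ⟩ : ∃ η : ℝ≥0∞, 0 < η ∧ η * σ ≤ ε / 2 := by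
    -- `σ + 1` instead of `σ` covers the case `σ = 0`.
    refine ⟨ε / 2 / (σ + 1), ENNReal.div_pos (ENNReal.half_pos hε.ne').ne' (ENNReal.add_ne_top.2 ⟨hσ, ENNReal.one_ne_top⟩), ?_⟩
    calc ε / 2 / (σ + 1) * σ ≤ ε / 2 / (σ + 1) * (σ + 1) := by gcongr; exact le_self_add
      _ ≤ ε / 2 := (ENNReal.div_mul_cancel (by simp) (ENNReal.add_ne_top.2 ⟨hσ, ENNReal.one_ne_top⟩)).le
  obtain ⟨δ, hδ, hb⟩ := key η hη
  have h2 : Tendsto (fun n => M * ∫⁻ h, {h | δ < ‖h‖}.indicator (k n) h ∂μ) atTop (𝓝 0) := by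
    simpa using ENNReal.Tendsto.const_mul (htail δ hδ) (Or.inr hM)
  filter_upwards [(ENNReal.tendsto_nhds_zero.1 h2) (ε / 2) (ENNReal.half_pos hε.ne')] with n hn
  calc _ ≤ _ := hb n
    _ ≤ ε / 2 + ε / 2 := add_le_add hησ hn
    _ = ε := ENNReal.add_halves ε

/-! ### Polar coordinates for radial kernels. -/

section Kernel

variable {E : Type*} [NormedAddCommGroup E] [NormedSpace ℝ E] [FiniteDimensional ℝ E]
  [Nontrivial E] [MeasurableSpace E] [BorelSpace E] (μ : Measure E) [μ.IsAddHaarMeasure]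

/-- Integration in polar coordinates of a nonnegative radial function. -/
theorem lintegral_ofReal_fun_norm {f : ℝ → ℝ} (hf : ∀ᵐ r ∂(volume.restrict (Ioi (0 : ℝ))), 0 ≤ f r)
    (hint : IntegrableOn (fun r => f r * r ^ (Module.finrank ℝ E - 1)) (Ioi 0)) :
    AEMeasurable (fun h : E => ENNReal.ofReal (f ‖h‖)) μ ∧
    ∫⁻ h : E, ENNReal.ofReal (f ‖h‖) ∂μ = ENNReal.ofReal (Module.finrank ℝ E *
      μ.real (Metric.ball 0 1) * ∫ r in Ioi (0 : ℝ), f r * r ^ (Module.finrank ℝ E - 1)) := by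
  have hpos : ∀ᵐ r ∂(volume.restrict (Ioi (0 : ℝ))), r ^ (Module.finrank ℝ E - 1) • max (f r) 0 =
      f r * r ^ (Module.finrank ℝ E - 1) := by
    filter_upwards [hf] with r hr
    rw [max_eq_left hr, smul_eq_mul, mul_comm]
  -- `f` is nonnegative only almost everywhere; its positive part is nonnegative everywhere and has
  -- the same `ENNReal.ofReal`.
  have h1 : Integrable (fun h : E => max (f ‖h‖) 0) μ :=
    (integrable_fun_norm_addHaar (f := fun r => max (f r) 0) μ).2
      (hint.congr (hpos.mono fun _ h => h.symm))
  have h2 : ∀ h : E, ENNReal.ofReal (f ‖h‖) = ENNReal.ofReal (max (f ‖h‖) 0) := fun h => by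
    rw [ENNReal.ofReal_max, ENNReal.ofReal_zero, max_eq_left (by simp)]
  simp_rw [h2]
  refine ⟨h1.aestronglyMeasurable.aemeasurable.ennreal_ofReal, ?_⟩
  rw [← ofReal_integral_eq_lintegral_ofReal h1 (ae_of_all _ fun h => le_max_right _ _),
    integral_fun_norm_addHaar μ (fun r => max (f r) 0), integral_congr_ae hpos]
  simp [mul_assoc]

end Kernel

/-! ### Radial mollifiers as concentrating kernels on `ℝ^d`. -/

section Mollifier

variable {d : ℕ} {ρ : ℕ → ℝ → ℝ}

theorem IsRadialMollifier.integrableOn (hρ : IsRadialMollifier d ρ) (n : ℕ) :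
    IntegrableOn (fun r => ρ n r * r ^ (d - 1)) (Ioi 0) := by
  -- The Bochner integral of a non-integrable function is `0`, so the normalisation to `1` forces
  -- integrability.
  by_contra h
  have := integral_undef h
  rw [hρ.integral_eq_one n] at this
  exact one_ne_zero this

/-- The common mass in `ℝ^d` of radial mollifiers. -/
noncomputable def radialMass (d : ℕ) : ℝ≥0∞ :=
  ENNReal.ofReal (d * (volume : Measure (EuclideanSpace ℝ (Fin d))).real (Metric.ball 0 1))

theorem radialMass_ne_zero [NeZero d] : radialMass d ≠ 0 := by
  have : 0 < (volume : Measure (EuclideanSpace ℝ (Fin d))).real (Metric.ball 0 1) :=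
    ENNReal.toReal_pos (Metric.measure_ball_pos _ _ one_pos).ne' measure_ball_lt_top.ne
  have hd : (0 : ℝ) < d := Nat.cast_pos.2 (Nat.pos_of_ne_zero (NeZero.ne d))
  rw [radialMass, Ne, ENNReal.ofReal_eq_zero, not_le]
  positivity

theorem radialMass_ne_top : radialMass d ≠ ⊤ := ENNReal.ofReal_ne_top

variable [NeZero d]

theorem IsRadialMollifier.aemeasurable (hρ : IsRadialMollifier d ρ) (n : ℕ) :
    AEMeasurable (fun h : EuclideanSpace ℝ (Fin d) => ENNReal.ofReal (ρ n ‖h‖)) :=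
  (lintegral_ofReal_fun_norm _ (hρ.nonneg n) (by simpa using hρ.integrableOn n)).1

theorem IsRadialMollifier.lintegral_eq (hρ : IsRadialMollifier d ρ) (n : ℕ) :
    ∫⁻ h : EuclideanSpace ℝ (Fin d), ENNReal.ofReal (ρ n ‖h‖) = radialMass d := by
  rw [(lintegral_ofReal_fun_norm _ (hρ.nonneg n) (by simpa using hρ.integrableOn n)).2]
  simp [hρ.integral_eq_one, radialMass]

theorem IsRadialMollifier.tendsto_lintegral_tail (hρ : IsRadialMollifier d ρ) {δ : ℝ}
    (hδ : 0 < δ) : Tendsto (fun n => ∫⁻ h : EuclideanSpace ℝ (Fin d),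
      {h : EuclideanSpace ℝ (Fin d) | δ < ‖h‖}.indicator
        (fun h => ENNReal.ofReal (ρ n ‖h‖)) h) atTop (𝓝 0) := by
  have h1 : ∀ n, ∫⁻ h : EuclideanSpace ℝ (Fin d),
      {h : EuclideanSpace ℝ (Fin d) | δ < ‖h‖}.indicator
        (fun h => ENNReal.ofReal (ρ n ‖h‖)) h = ENNReal.ofReal (d *
      (volume : Measure (EuclideanSpace ℝ (Fin d))).real (Metric.ball 0 1) *
        ∫ r in Ioi δ, ρ n r * r ^ (d - 1)) := by
    intro n
    have h2 : ∀ r : ℝ, (Ioi δ).indicator (ρ n) r * r ^ (d - 1) =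
        (Ioi δ).indicator (fun r => ρ n r * r ^ (d - 1)) r := fun r => by
      by_cases hr : r ∈ Ioi δ <;> simp [hr]
    have h3 : ∀ h : EuclideanSpace ℝ (Fin d), {h : EuclideanSpace ℝ (Fin d) | δ < ‖h‖}.indicator
        (fun h => ENNReal.ofReal (ρ n ‖h‖)) h =
        ENNReal.ofReal ((Ioi δ).indicator (ρ n) ‖h‖) := fun h => by
      by_cases hr : δ < ‖h‖ <;> simp [hr]
    simp_rw [h3]
    rw [(lintegral_ofReal_fun_norm (f := (Ioi δ).indicator (ρ n)) _ ?_ ?_).2]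
    · simp only [finrank_euclideanSpace, Fintype.card_fin, h2]
      rw [setIntegral_indicator measurableSet_Ioi,
        inter_eq_self_of_subset_right (Ioi_subset_Ioi hδ.le)]
    · filter_upwards [hρ.nonneg n] with r hr
      exact indicator_apply_nonneg fun _ => hr
    · simp only [finrank_euclideanSpace, Fintype.card_fin, h2]
      exact (hρ.integrableOn n).indicator measurableSet_Ioi
  simp_rw [h1]
  have := ENNReal.tendsto_ofReal ((hρ.tendsto_tail δ hδ).const_mul (d *
      (volume : Measure (EuclideanSpace ℝ (Fin d))).real (Metric.ball 0 1)))
  simpa using this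

theorem IsRadialMollifier.tendsto_lintegral_mul (hρ : IsRadialMollifier d ρ)
    {G : EuclideanSpace ℝ (Fin d) → ℝ≥0∞} {M : ℝ≥0∞} (hM : M ≠ ⊤) (hG : ∀ h, G h ≤ M)
    (hG0 : Tendsto G (𝓝 0) (𝓝 0)) :
    Tendsto (fun n => ∫⁻ h, G h * ENNReal.ofReal (ρ n ‖h‖)) atTop (𝓝 0) :=
  tendsto_lintegral_mul_of_concentrating hρ.aemeasurable radialMass_ne_top hM hρ.lintegral_eq
    (fun _ hδ => hρ.tendsto_lintegral_tail hδ) hG hG0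

end Mollifier

/-! ### Taylor remainders tested against smooth functions. -/

/-- The first-order Taylor remainder of a test function is `o(‖h‖)` uniformly, with a bound that
is linear at infinity. -/
theorem exists_taylor_bound {E : Type*} [NormedAddCommGroup E] [InnerProductSpace ℝ E]
    {φ : E → ℝ} (hφ : ContDiff ℝ ∞ φ) (hc : HasCompactSupport φ) :
    ∃ C : NNReal, ∀ x h : E, ‖φ (x - h) - φ x + fderiv ℝ φ x h‖ₑ ≤ C * min ‖h‖ₑ 1 * ‖h‖ₑ := by
  obtain ⟨C₁, h₁⟩ := hφ.lipschitzWith_of_hasCompactSupport hc (by simp)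
  obtain ⟨C₂, h₂⟩ := (hφ.fderiv_right (m := ∞) le_rfl).lipschitzWith_of_hasCompactSupport
    (hc.fderiv ℝ) (by simp)
  have hd : Differentiable ℝ φ := hφ.differentiable (by simp)
  have b₁ : ∀ x h : E, ‖φ (x - h) - φ x + fderiv ℝ φ x h‖ ≤ 2 * C₁ * ‖h‖ := by
    intro x h
    calc _ ≤ ‖φ (x - h) - φ x‖ + ‖fderiv ℝ φ x h‖ := norm_add_le _ _
      _ ≤ C₁ * ‖h‖ + C₁ * ‖h‖ := by
        refine add_le_add ?_ (((fderiv ℝ φ x).le_opNorm h).trans ?_)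
        · simpa using h₁.norm_sub_le (x - h) x
        · gcongr
          exact norm_fderiv_le_of_lipschitz ℝ h₁
      _ = _ := by ring
  have b₂ : ∀ x h : E, ‖φ (x - h) - φ x + fderiv ℝ φ x h‖ ≤ C₂ * ‖h‖ * ‖h‖ := by
    intro x h
    -- Mean value inequality for `φ` minus its linearisation at `x`: on this ball the derivative
    -- moves by at most `C₂ * ‖h‖`.
    have := (convex_closedBall x ‖h‖).norm_image_sub_le_of_norm_fderiv_le' (𝕜 := ℝ) (f := φ)
      (φ := fderiv ℝ φ x) (C := C₂ * ‖h‖) (x := x) (y := x - h) (fun z _ => hd z)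
      (fun z hz => (h₂.norm_sub_le z x).trans (by
        gcongr; simpa [dist_eq_norm] using hz)) (by simp) (by simp)
    simpa using this
  refine ⟨max (2 * C₁) C₂, fun x h => ?_⟩
  have e : ∀ (C : NNReal) (a b : ℝ), ‖a‖ ≤ C * b → 0 ≤ b → ‖a‖ₑ ≤ C * ENNReal.ofReal b := by
    intro C a b hab hb
    rw [← ofReal_norm, ← ENNReal.ofReal_coe_nnreal, ← ENNReal.ofReal_mul C.coe_nonneg]
    exact ENNReal.ofReal_le_ofReal hab
  rw [mul_assoc]
  rcases le_total ‖h‖ₑ 1 with hh | hh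
  · rw [min_eq_left hh]
    refine (e C₂ _ (‖h‖ * ‖h‖) (by simpa [mul_assoc] using b₂ x h) (by positivity)).trans ?_
    rw [ENNReal.ofReal_mul (norm_nonneg _), ofReal_norm]
    gcongr
    exact le_max_right _ _
  · rw [min_eq_right hh, one_mul]
    refine (e (2 * C₁) _ ‖h‖ (by simpa using b₁ x h) (by positivity)).trans ?_
    rw [ofReal_norm]
    gcongr
    exact le_max_left _ _

section Defect

variable {E : Type*} [NormedAddCommGroup E] [InnerProductSpace ℝ E] [FiniteDimensional ℝ E]
  [MeasurableSpace E] [BorelSpace E]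

/-- The `L¹` norm of the first-order Taylor remainder of `u` at displacement `h`, computed with
the candidate gradient `U`. -/
noncomputable def taylorRemainder (u : E → ℝ) (U : E → E) (h : E) : ℝ≥0∞ :=
  ∫⁻ x, ‖u (x + h) - u x - inner ℝ (U x) h‖ₑ

/-- The vector `∫ u ∇φ + φ U`, which vanishes for every test function `φ` exactly when `U` is the
weak gradient of `u`. -/
noncomputable def weakDefect (u : E → ℝ) (U : E → E) (φ : E → ℝ) : E :=
  ∫ x, (u x • gradient φ x + φ x • U x)

variable {u : E → ℝ} {U : E → E} {φ : E → ℝ}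

theorem integrable_mul_fderiv (hu : Integrable u) (hφ : ContDiff ℝ ∞ φ) (hc : HasCompactSupport φ)
    (h : E) : Integrable (fun x => u x * fderiv ℝ φ x h) := by
  have h1 : Continuous fun x => fderiv ℝ φ x h :=
    (hφ.continuous_fderiv (by simp)).clm_apply continuous_const
  obtain ⟨C, hC⟩ := (hc.fderiv_apply ℝ h).exists_bound_of_continuous h1
  exact hu.mul_bdd h1.aestronglyMeasurable (ae_of_all _ hC)

theorem integrable_mul_of_test (hu : Integrable u) (hφ : Continuous φ) (hc : HasCompactSupport φ) :
    Integrable (fun x => u x * φ x) := by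
  obtain ⟨C, hC⟩ := hc.exists_bound_of_continuous hφ
  exact hu.mul_bdd hφ.aestronglyMeasurable (ae_of_all _ hC)

theorem inner_weakDefect (hu : Integrable u) (hU : Integrable U) (hφ : ContDiff ℝ ∞ φ)
    (hc : HasCompactSupport φ) (h : E) :
    inner ℝ (weakDefect u U φ) h =
      (∫ x, u x * fderiv ℝ φ x h) + ∫ x, inner ℝ (U x) h * φ x := by
  have hg : Continuous (gradient φ) :=
    (InnerProductSpace.toDual ℝ E).symm.continuous.comp (hφ.continuous_fderiv (by simp))
  have hgc : HasCompactSupport (gradient φ) :=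
    (hc.fderiv ℝ).comp_left (map_zero _)
  obtain ⟨C, hC⟩ := hgc.exists_bound_of_continuous hg
  obtain ⟨K, hK⟩ := hc.exists_bound_of_continuous hφ.continuous
  have h1 : Integrable fun x => u x • gradient φ x :=
    hu.smul_bdd C hg.aestronglyMeasurable (ae_of_all _ hC)
  have h2 : Integrable fun x => φ x • U x :=
    hU.bdd_smul K hφ.continuous.aestronglyMeasurable (ae_of_all _ hK)
  have h3 : Integrable fun x => u x • gradient φ x + φ x • U x := h1.add h2
  rw [weakDefect, real_inner_comm, ← integral_inner h3,
    ← integral_add (integrable_mul_fderiv hu hφ hc h)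
      (integrable_mul_of_test (hU.inner_const h) hφ.continuous hc)]
  refine integral_congr_ae (ae_of_all _ fun x => ?_)
  have : inner ℝ h (gradient φ x) = fderiv ℝ φ x h := by
    rw [real_inner_comm, gradient, InnerProductSpace.toDual_symm_apply]
  simp only [inner_add_right, inner_smul_right, this, real_inner_comm h (U x)]
  ring

theorem integrable_taylorRemainder (hu : Integrable u) (hU : Integrable U) (h : E) :
    Integrable fun x => u (x + h) - u x - inner ℝ (U x) h :=
  ((hu.comp_add_right h).sub hu).sub (hU.inner_const h)

/-- Testing the Taylor remainder against `φ` yields the weak defect up to the Taylor remainder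
of `φ`. -/
theorem inner_weakDefect_eq (hu : Integrable u) (hU : Integrable U) (hφ : ContDiff ℝ ∞ φ)
    (hc : HasCompactSupport φ) (h : E) :
    inner ℝ (weakDefect u U φ) h =
      (∫ x, u x * (φ (x - h) - φ x + fderiv ℝ φ x h)) -
        ∫ x, (u (x + h) - u x - inner ℝ (U x) h) * φ x := by
  have h1 := integrable_mul_of_test hu hφ.continuous hc
  have h2 : Integrable fun x => u (x + h) * φ x :=
    integrable_mul_of_test (hu.comp_add_right h) hφ.continuous hc
  have h3 : Integrable fun x => u x * φ (x - h) := by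
    simpa using h2.comp_sub_right h
  have h4 := integrable_mul_fderiv hu hφ hc h
  have h5 := integrable_mul_of_test (hU.inner_const h) hφ.continuous hc
  have e1 : ∫ x, u x * φ (x - h) = ∫ x, u (x + h) * φ x := by
    rw [← integral_add_right_eq_self _ h]; simp
  simp_rw [mul_add, mul_sub, sub_mul]
  have h6 : Integrable fun x => u x * φ (x - h) - u x * φ x := h3.sub h1
  have h7 : Integrable fun x => u (x + h) * φ x - u x * φ x := h2.sub h1
  rw [integral_add h6 h4, integral_sub h3 h1, integral_sub h7 h5,
    integral_sub h2 h1, e1, inner_weakDefect hu hU hφ hc]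
  ring

/-- `A` is the `L¹` norm of `u` times the Taylor constant of `φ`, and `B` comes from a uniform bound
on `φ`; neither depends on `h`. -/
theorem exists_enorm_inner_weakDefect_le (hu : Integrable u) (hU : Integrable U)
    (hφ : ContDiff ℝ ∞ φ) (hc : HasCompactSupport φ) :
    ∃ A B : ℝ≥0∞, A ≠ ⊤ ∧ B ≠ ⊤ ∧ ∀ h : E, ‖inner ℝ (weakDefect u U φ) h‖ₑ ≤
      A * min ‖h‖ₑ 1 * ‖h‖ₑ + B * taylorRemainder u U h := by
  obtain ⟨C, hC⟩ := exists_taylor_bound hφ hc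
  obtain ⟨K, hK⟩ := hc.exists_bound_of_continuous hφ.continuous
  refine ⟨(∫⁻ x, ‖u x‖ₑ) * C, ENNReal.ofReal K,
    ENNReal.mul_ne_top hu.2.ne ENNReal.coe_ne_top, ENNReal.ofReal_ne_top, fun h => ?_⟩
  rw [inner_weakDefect_eq hu hU hφ hc]
  refine (enorm_sub_le).trans (add_le_add ?_ ?_)
  · refine (enorm_integral_le_lintegral_enorm _).trans ?_
    rw [mul_assoc, mul_assoc, ← lintegral_mul_const'' _ hu.1.enorm]
    refine lintegral_mono fun x => ?_
    rw [enorm_mul]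
    gcongr
    simpa [mul_assoc] using hC x h
  · refine (enorm_integral_le_lintegral_enorm _).trans ?_
    rw [taylorRemainder, ← lintegral_const_mul'' _ (integrable_taylorRemainder hu hU h).1.enorm]
    refine lintegral_mono fun x => ?_
    rw [enorm_mul, mul_comm]
    gcongr
    rw [← ofReal_norm]
    exact ENNReal.ofReal_le_ofReal (hK x)

end Defect

/-! ### Averages of linear forms against radial weights. -/

section Radial

variable {E : Type*} [NormedAddCommGroup E] [InnerProductSpace ℝ E] [FiniteDimensional ℝ E]
  [MeasurableSpace E] [BorelSpace E]

/-- By rotation invariance, the mean of `|⟪a, h⟫| / ‖h‖` against a radial weight depends only on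
`‖a‖`. -/
theorem lintegral_enorm_inner_mul_radial_congr (k : ℝ → ℝ≥0∞) {a b : E} (hab : ‖a‖ = ‖b‖) :
    ∫⁻ h : E, ‖h‖ₑ⁻¹ * ‖inner ℝ a h‖ₑ * k ‖h‖ = ∫⁻ h : E, ‖h‖ₑ⁻¹ * ‖inner ℝ b h‖ₑ * k ‖h‖ := by
  -- Vectors of equal norm are exchanged by the reflection in the hyperplane orthogonal to their
  -- difference.
  set R : E ≃ₗᵢ[ℝ] E := (ℝ ∙ (b - a))ᗮ.reflection
  have hR : R b = a := Submodule.reflection_sub hab.symm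
  have hme : MeasurableEmbedding R := R.toHomeomorph.measurableEmbedding
  rw [← (LinearIsometryEquiv.measurePreserving R).lintegral_comp_emb hme]
  refine lintegral_congr fun h => ?_
  rw [← hR, R.inner_map_map, R.norm_map, R.enorm_map]

/-- A lower bound for the mean of `|⟪a, h⟫| / ‖h‖` against a radial weight. -/
theorem enorm_mul_lintegral_radial_le [Nontrivial E] {k : ℝ → ℝ≥0∞}
    (hk : AEMeasurable fun h : E => k ‖h‖) (a : E) :
    ‖a‖ₑ * ∫⁻ h : E, k ‖h‖ ≤
      Module.finrank ℝ E * ∫⁻ h : E, ‖h‖ₑ⁻¹ * ‖inner ℝ a h‖ₑ * k ‖h‖ := by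
  set b := stdOrthonormalBasis ℝ E
  -- Each basis direction, scaled to norm `‖a‖`, has the same mean as `a`; summing them with `‖h‖ ≤
  -- ∑ |⟪b i, h⟫|` produces the factor `finrank`.
  have hI : ∀ i, ∫⁻ h : E, ‖h‖ₑ⁻¹ * ‖inner ℝ (‖a‖ • b i) h‖ₑ * k ‖h‖ =
      ∫⁻ h : E, ‖h‖ₑ⁻¹ * ‖inner ℝ a h‖ₑ * k ‖h‖ := fun i =>
    lintegral_enorm_inner_mul_radial_congr k (by simp [norm_smul, b.orthonormal.1 i])
  have hm : ∀ i, AEMeasurable fun h : E => ‖h‖ₑ⁻¹ * ‖inner ℝ (‖a‖ • b i) h‖ₑ * k ‖h‖ := fun i =>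
    (AEMeasurable.mul (by fun_prop) (by fun_prop)).mul hk
  calc ‖a‖ₑ * ∫⁻ h : E, k ‖h‖ = ∫⁻ h : E, ‖a‖ₑ * k ‖h‖ := (lintegral_const_mul'' _ hk).symm
    _ ≤ ∫⁻ h : E, ∑ i, ‖h‖ₑ⁻¹ * ‖inner ℝ (‖a‖ • b i) h‖ₑ * k ‖h‖ := by
      refine lintegral_mono_ae ?_
      have h0 : ∀ᵐ h : E, h ≠ 0 := Measure.ae_ne volume 0
      filter_upwards [h0] with h hh
      rw [← Finset.sum_mul, ← Finset.mul_sum]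
      gcongr
      have h1 : ‖h‖ₑ ≤ ∑ i, ‖inner ℝ (b i) h‖ₑ := by
        conv_lhs => rw [← b.sum_repr' h]
        refine (enorm_sum_le _ _).trans (Finset.sum_le_sum fun i _ => ?_)
        rw [enorm_smul, ← ofReal_norm (b i), b.orthonormal.1 i]
        simp
      have h2 : ∀ i, ‖inner ℝ (‖a‖ • b i) h‖ₑ = ‖a‖ₑ * ‖inner ℝ (b i) h‖ₑ := fun i => by
        rw [real_inner_smul_left, enorm_mul, enorm_norm]
      simp_rw [h2]
      rw [← Finset.mul_sum, mul_left_comm]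
      have h3 : ‖h‖ₑ⁻¹ * ‖h‖ₑ = 1 := ENNReal.inv_mul_cancel (by simpa using hh) enorm_ne_top
      calc ‖a‖ₑ = ‖a‖ₑ * (‖h‖ₑ⁻¹ * ‖h‖ₑ) := by rw [h3, mul_one]
        _ ≤ _ := by gcongr
    _ = Module.finrank ℝ E * ∫⁻ h : E, ‖h‖ₑ⁻¹ * ‖inner ℝ a h‖ₑ * k ‖h‖ := by
      rw [lintegral_finsetSum' _ fun i _ => hm i]
      simp [hI]

end Radial

/-! ### Vanishing defect implies weak gradient. -/

section WeakGradient

variable {d : ℕ} {u : EuclideanSpace ℝ (Fin d) → ℝ}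
  {U : EuclideanSpace ℝ (Fin d) → EuclideanSpace ℝ (Fin d)}

/-- The coordinates of `weakDefect` are the errors in integration by parts; gathering them in one
vector lets the rotation argument treat all directions at once. -/
theorem hasWeakGradient_iff_weakDefect (hu : Integrable u) (hU : Integrable U) :
    HasWeakGradient u U ↔ ∀ φ : EuclideanSpace ℝ (Fin d) → ℝ, ContDiff ℝ ∞ φ →
      HasCompactSupport φ → weakDefect u U φ = 0 := by
  have key : ∀ φ : EuclideanSpace ℝ (Fin d) → ℝ, ContDiff ℝ ∞ φ → HasCompactSupport φ → ∀ i,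
      weakDefect u U φ i = (∫ x, u x * fderiv ℝ φ x (EuclideanSpace.single i 1)) +
        ∫ x, U x i * φ x := by
    intro φ hφ hc i
    simpa [EuclideanSpace.inner_single_right] using
      inner_weakDefect hu hU hφ hc (EuclideanSpace.single i 1)
  constructor
  · intro h φ hφ hc
    ext i
    rw [key φ hφ hc i, h.integral_eq φ hφ hc i]
    simp
  · intro h
    refine ⟨hu.locallyIntegrable, hU.locallyIntegrable, fun φ hφ hc i => ?_⟩
    rw [eq_neg_iff_add_eq_zero, ← key φ hφ hc i, h φ hφ hc]
    rfl

theorem aemeasurable_taylorDefect_integrand {k : EuclideanSpace ℝ (Fin d) → ℝ≥0∞}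
    (hk : AEMeasurable k) (hu : Integrable u) (hU : Integrable U) :
    AEMeasurable (Function.uncurry fun x h : EuclideanSpace ℝ (Fin d) =>
      ‖h‖ₑ⁻¹ * ‖u (x + h) - u x - inner ℝ (U x) h‖ₑ * k h) (volume.prod volume) := by
  have h1 : AEStronglyMeasurable (fun p : EuclideanSpace ℝ (Fin d) × EuclideanSpace ℝ (Fin d) =>
      u (p.1 + p.2)) (volume.prod volume) :=
    hu.1.comp_quasiMeasurePreserving (quasiMeasurePreserving_add _ _)
  have h2 : AEStronglyMeasurable (fun p : EuclideanSpace ℝ (Fin d) × EuclideanSpace ℝ (Fin d) =>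
      u p.1) (volume.prod volume) := hu.1.comp_fst
  have h3 : AEStronglyMeasurable (fun p : EuclideanSpace ℝ (Fin d) × EuclideanSpace ℝ (Fin d) =>
      inner ℝ (U p.1) p.2) (volume.prod volume) :=
    hU.1.comp_fst.inner measurable_snd.aestronglyMeasurable
  exact (AEMeasurable.mul (by fun_prop) ((h1.sub h2).sub h3).enorm).mul hk.comp_snd

theorem taylorDefect_eq {ρ : ℝ → ℝ}
    (hρ : AEMeasurable fun h : EuclideanSpace ℝ (Fin d) => ENNReal.ofReal (ρ ‖h‖))
    (hu : Integrable u) (hU : Integrable U) :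
    taylorDefect ρ u U = ∫⁻ h, ‖h‖ₑ⁻¹ * taylorRemainder u U h * ENNReal.ofReal (ρ ‖h‖) := by
  have e : ∀ x h : EuclideanSpace ℝ (Fin d),
      ENNReal.ofReal (|u (x + h) - u x - inner ℝ (U x) h| / ‖h‖ * ρ ‖h‖) =
      ‖h‖ₑ⁻¹ * ‖u (x + h) - u x - inner ℝ (U x) h‖ₑ * ENNReal.ofReal (ρ ‖h‖) := by
    intro x h
    rw [ENNReal.ofReal_mul (by positivity)]
    -- At `h = 0` the left side is `0` by real division by zero, and the right side is `⊤ * 0 = 0`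
    -- as the remainder vanishes.
    rcases eq_or_ne h 0 with rfl | hh
    · simp
    · rw [ENNReal.ofReal_div_of_pos (norm_pos_iff.2 hh), ← Real.norm_eq_abs, ofReal_norm,
        ofReal_norm, div_eq_mul_inv, mul_comm ‖h‖ₑ⁻¹]
  simp_rw [taylorDefect, e]
  rw [lintegral_lintegral_swap (aemeasurable_taylorDefect_integrand hρ hu hU)]
  refine lintegral_congr fun h => ?_
  have hm := (integrable_taylorRemainder hu hU h).1.enorm
  rw [lintegral_mul_const'' _ (hm.const_mul _), lintegral_const_mul'' _ hm, taylorRemainder]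

/-- If the Taylor defect with respect to radial mollifiers tends to zero, then the candidate
gradient is the weak gradient. -/
theorem IsRadialMollifier.hasWeakGradient [NeZero d] {ρ : ℕ → ℝ → ℝ} (hρ : IsRadialMollifier d ρ)
    (hu : Integrable u) (hU : Integrable U)
    (h : Tendsto (fun n => taylorDefect (ρ n) u U) atTop (𝓝 0)) : HasWeakGradient u U := by
  rw [hasWeakGradient_iff_weakDefect hu hU]
  intro φ hφ hc
  obtain ⟨A, B, hA, hB, hAB⟩ := exists_enorm_inner_weakDefect_le hu hU hφ hc
  set a := weakDefect u U φ
  have hG0 : Tendsto (fun h : EuclideanSpace ℝ (Fin d) => A * min ‖h‖ₑ 1) (𝓝 0) (𝓝 0) := by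
    have h1 : Tendsto (fun h : EuclideanSpace ℝ (Fin d) => min ‖h‖ₑ 1) (𝓝 0) (𝓝 0) := by
      have : Continuous fun h : EuclideanSpace ℝ (Fin d) => min ‖h‖ₑ 1 := by fun_prop
      simpa using this.tendsto 0
    simpa using ENNReal.Tendsto.const_mul h1 (Or.inr hA)
  have h1 := hρ.tendsto_lintegral_mul hA
    (fun h => mul_le_of_le_one_right' (min_le_right _ _)) hG0
  have h2 : Tendsto (fun n => B * taylorDefect (ρ n) u U) atTop (𝓝 0) := by
    simpa using ENNReal.Tendsto.const_mul h (Or.inr hB)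
  have h3 : ∀ n, ‖a‖ₑ * radialMass d ≤ d * ((∫⁻ h : EuclideanSpace ℝ (Fin d),
      A * min ‖h‖ₑ 1 * ENNReal.ofReal (ρ n ‖h‖)) + B * taylorDefect (ρ n) u U) := by
    intro n
    have hk := hρ.aemeasurable n
    have hm : AEMeasurable fun h : EuclideanSpace ℝ (Fin d) =>
        A * min ‖h‖ₑ 1 * ENNReal.ofReal (ρ n ‖h‖) := AEMeasurable.mul (by fun_prop) hk
    have h4 := enorm_mul_lintegral_radial_le (k := fun r => ENNReal.ofReal (ρ n r)) hk a
    rw [hρ.lintegral_eq] at h4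
    simp only [finrank_euclideanSpace, Fintype.card_fin] at h4
    refine h4.trans ?_
    gcongr
    rw [taylorDefect_eq hk hu hU, ← lintegral_const_mul' _ _ hB,
      ← lintegral_add_left' hm]
    refine lintegral_mono fun h => ?_
    calc ‖h‖ₑ⁻¹ * ‖inner ℝ a h‖ₑ * ENNReal.ofReal (ρ n ‖h‖)
        ≤ ‖h‖ₑ⁻¹ * (A * min ‖h‖ₑ 1 * ‖h‖ₑ + B * taylorRemainder u U h) *
          ENNReal.ofReal (ρ n ‖h‖) := by gcongr; exact hAB h
      _ = (‖h‖ₑ⁻¹ * ‖h‖ₑ) * (A * min ‖h‖ₑ 1 * ENNReal.ofReal (ρ n ‖h‖)) +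
          B * (‖h‖ₑ⁻¹ * taylorRemainder u U h * ENNReal.ofReal (ρ n ‖h‖)) := by ring
      _ ≤ _ := add_le_add_left (mul_le_of_le_one_left' (ENNReal.inv_mul_le_one _)) _
  have h5 := ENNReal.Tendsto.const_mul (a := (d : ℝ≥0∞)) (h1.add h2) (Or.inr (by simp))
  have h6 : ‖a‖ₑ * radialMass d ≤ 0 := by
    refine ge_of_tendsto' (by simpa using h5) h3
  have h7 : ‖a‖ₑ * radialMass d = 0 := le_antisymm h6 bot_le
  simpa [radialMass_ne_zero] using h7

end WeakGradient

/-! ### Weak gradient implies vanishing defect. -/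

section Translation

/-- Translations are continuous in `L¹`. -/
theorem tendsto_lintegral_enorm_translate_sub {E F : Type*} [NormedAddCommGroup E]
    [NormedSpace ℝ E] [FiniteDimensional ℝ E] [MeasurableSpace E] [BorelSpace E]
    [NormedAddCommGroup F] {μ : Measure E} [μ.IsAddHaarMeasure] {V : E → F}
    (hV : Integrable V μ) :
    Tendsto (fun k : E => ∫⁻ x, ‖V (x + k) - V x‖ₑ ∂μ) (𝓝 0) (𝓝 0) := by
  have : Fact ((1 : ℝ≥0∞) ≠ ⊤) := ⟨ENNReal.one_ne_top⟩
  have hL : MemLp V 1 μ := memLp_one_iff_integrable.2 hV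
  set f : Lp F 1 μ := hL.toLp V
  -- Translations act continuously on `Lp`.
  have hc : Continuous fun k : E => edist (DomAddAct.mk k +ᵥ f) f :=
    ((DomAddAct.continuous_mk.vadd continuous_const).edist continuous_const)
  have h0 := hc.tendsto 0
  have e : ∀ k : E, edist (DomAddAct.mk k +ᵥ f) f = ∫⁻ x, ‖V (x + k) - V x‖ₑ ∂μ := by
    intro k
    rw [DomAddAct.mk_vadd_toLp, Lp.edist_toLp_toLp, eLpNorm_one_eq_lintegral_enorm]
    simp [add_comm]
  simp only [e] at h0
  simpa using h0

variable {E : Type*} [NormedAddCommGroup E] [InnerProductSpace ℝ E] [FiniteDimensional ℝ E]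
  [MeasurableSpace E] [BorelSpace E]

/-- Each slice is a translation. This carries joint integrability from `V x` to `V (x + t • h)`, as
needed for the Fubini swaps. -/
theorem measurePreserving_shear (h : E) :
    MeasurePreserving (fun p : ℝ × E => (p.1, p.2 + p.1 • h))
      ((volume.restrict (Ioc (0 : ℝ) 1)).prod volume)
      ((volume.restrict (Ioc (0 : ℝ) 1)).prod volume) :=
  (MeasurePreserving.id _).skew_product (g := fun t x => x + t • h) (by fun_prop)
    (ae_of_all _ fun t => (measurePreserving_add_right volume (t • h)).map_eq)

theorem integrable_translate {F : Type*} [NormedAddCommGroup F] {V : E → F} (hV : Integrable V)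
    (h : E) : Integrable (fun p : ℝ × E => V (p.2 + p.1 • h))
      ((volume.restrict (Ioc (0 : ℝ) 1)).prod volume) :=
  ((measurePreserving_shear h).integrable_comp (hV.comp_snd _).1).2 (hV.comp_snd _)

variable {u : E → ℝ} {V : E → E}

/-- The fundamental theorem of calculus along `h` for functions with an integrable weak
gradient. -/
theorem ae_sub_eq_integral_of_weakDefect (hu : Integrable u) (hV : Integrable V)
    (hw : ∀ φ : E → ℝ, ContDiff ℝ ∞ φ → HasCompactSupport φ → weakDefect u V φ = 0) (h : E) :
    ∀ᵐ x, u (x + h) - u x = ∫ t in Ioc (0 : ℝ) 1, inner ℝ (V (x + t • h)) h := by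
  have hint : Integrable (fun p : ℝ × E => inner ℝ (V (p.2 + p.1 • h)) h)
      ((volume.restrict (Ioc (0 : ℝ) 1)).prod volume) := (integrable_translate hV h).inner_const h
  -- Two locally integrable functions agree almost everywhere once all test functions integrate
  -- equally against them.
  refine ae_eq_of_integral_contDiff_smul_eq ((hu.comp_add_right h).sub hu).locallyIntegrable
    hint.integral_prod_right.locallyIntegrable fun φ hφ hc => ?_
  have hcont : Continuous fun x => fderiv ℝ φ x h :=
    (hφ.continuous_fderiv (by simp)).clm_apply continuous_const
  obtain ⟨C, hC⟩ := (hc.fderiv_apply ℝ h).exists_bound_of_continuous hcont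
  obtain ⟨K, hK⟩ := hc.exists_bound_of_continuous hφ.continuous
  have h1 := integrable_mul_of_test hu hφ.continuous hc
  have h2 : Integrable fun x => u (x + h) * φ x :=
    integrable_mul_of_test (hu.comp_add_right h) hφ.continuous hc
  have h3 : Integrable fun x => u x * φ (x - h) := by simpa using h2.comp_sub_right h
  have e1 : ∫ x, u x * φ (x - h) = ∫ x, u (x + h) * φ x := by
    rw [← integral_add_right_eq_self _ h]; simp
  have ftc : ∀ x, φ (x - h) - φ x = -∫ t in Ioc (0 : ℝ) 1, fderiv ℝ φ (x - t • h) h := by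
    intro x
    have hd : ∀ t ∈ uIcc (0 : ℝ) 1, HasDerivAt (fun t : ℝ => φ (x - t • h))
        (-fderiv ℝ φ (x - t • h) h) t := by
      intro t _
      have h4 : HasDerivAt (fun t : ℝ => x - t • h) (-h) t := by
        simpa using ((hasDerivAt_id t).smul_const h).const_sub x
      have h5 := ((hφ.differentiable (by simp)) (x - t • h)).hasFDerivAt.comp_hasDerivAt t h4
      simpa [Function.comp_def] using h5
    have h6 := intervalIntegral.integral_eq_sub_of_hasDerivAt hd
      ((by fun_prop : Continuous fun t : ℝ => -fderiv ℝ φ (x - t • h) h).intervalIntegrable 0 1)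
    rw [intervalIntegral.integral_neg, intervalIntegral.integral_of_le zero_le_one] at h6
    rw [h6]
    simp
  have hint2 : Integrable (fun p : E × ℝ => u p.1 * fderiv ℝ φ (p.1 - p.2 • h) h)
      (volume.prod (volume.restrict (Ioc (0 : ℝ) 1))) :=
    (hu.comp_fst _).mul_bdd (c := C) (by fun_prop : Continuous fun p : E × ℝ =>
      fderiv ℝ φ (p.1 - p.2 • h) h).aestronglyMeasurable (ae_of_all _ fun p => hC _)
  have hint3 : Integrable (fun p : ℝ × E => φ p.2 * inner ℝ (V (p.2 + p.1 • h)) h)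
      ((volume.restrict (Ioc (0 : ℝ) 1)).prod volume) :=
    hint.bdd_mul (c := K) (hφ.continuous.comp continuous_snd).aestronglyMeasurable
      (ae_of_all _ fun p => hK _)
  -- The weak gradient identity for the translated test function `φ (x - t • h)`, followed by a
  -- change of variables.
  have slice : ∀ t : ℝ, -∫ x, u x * fderiv ℝ φ (x - t • h) h =
      ∫ x, φ x * inner ℝ (V (x + t • h)) h := by
    intro t
    have hφt : ContDiff ℝ ∞ fun x => φ (x - t • h) := hφ.comp (contDiff_id.sub contDiff_const)
    have hct : HasCompactSupport fun x => φ (x - t • h) := by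
      simpa [sub_eq_add_neg, Function.comp_def] using hc.comp_homeomorph (Homeomorph.addRight (-(t • h)))
    have h7 := inner_weakDefect hu hV hφt hct h
    rw [hw _ hφt hct, inner_zero_left] at h7
    simp only [fderiv_comp_sub] at h7
    rw [← integral_add_right_eq_self (fun x => inner ℝ (V x) h * φ (x - t • h)) (t • h)] at h7
    simp only [add_sub_cancel_right, mul_comm _ (φ _)] at h7
    linarith
  calc ∫ x, φ x • (u (x + h) - u x) = ∫ x, u x * (φ (x - h) - φ x) := by
        simp_rw [mul_sub, smul_eq_mul, mul_sub, mul_comm (φ _)]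
        rw [integral_sub h2 h1, integral_sub h3 h1, e1]
    _ = -∫ x, ∫ t in Ioc (0 : ℝ) 1, u x * fderiv ℝ φ (x - t • h) h := by
        rw [← integral_neg]
        refine integral_congr_ae (ae_of_all _ fun x => ?_)
        simp only [ftc, integral_const_mul]
        ring
    _ = ∫ t in Ioc (0 : ℝ) 1, -∫ x, u x * fderiv ℝ φ (x - t • h) h := by
        rw [integral_integral_swap hint2, integral_neg]
    _ = ∫ t in Ioc (0 : ℝ) 1, ∫ x, φ x * inner ℝ (V (x + t • h)) h := by simp_rw [slice]
    _ = ∫ x, φ x • ∫ t in Ioc (0 : ℝ) 1, inner ℝ (V (x + t • h)) h := by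
        rw [integral_integral_swap hint3]
        simp_rw [integral_const_mul, smul_eq_mul]

/-- The mean of the `L¹` modulus of continuity of `V` along the segment from `0` to `h`. -/
noncomputable def meanModulus (V : E → E) (h : E) : ℝ≥0∞ :=
  ∫⁻ t in Ioc (0 : ℝ) 1, ∫⁻ x, ‖V (x + t • h) - V x‖ₑ

/-- The remainder at `x` is the mean over `t` of `⟪V (x + t • h) - V x, h⟫`; Cauchy–Schwarz and
Tonelli finish. -/
theorem taylorRemainder_le (hu : Integrable u) (hV : Integrable V)
    (hw : ∀ φ : E → ℝ, ContDiff ℝ ∞ φ → HasCompactSupport φ → weakDefect u V φ = 0) (h : E) :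
    taylorRemainder u V h ≤ ‖h‖ₑ * meanModulus V h := by
  have hint := integrable_translate hV h
  have hdiff : Integrable (fun p : ℝ × E => V (p.2 + p.1 • h) - V p.2)
      ((volume.restrict (Ioc (0 : ℝ) 1)).prod volume) := hint.sub (hV.comp_snd _)
  calc taylorRemainder u V h
      ≤ ∫⁻ x, ∫⁻ t in Ioc (0 : ℝ) 1, ‖h‖ₑ * ‖V (x + t • h) - V x‖ₑ := by
        refine lintegral_mono_ae ?_
        filter_upwards [ae_sub_eq_integral_of_weakDefect hu hV hw h, hint.prod_left_ae] with x hx hi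
        have h1 : u (x + h) - u x - inner ℝ (V x) h =
            ∫ t in Ioc (0 : ℝ) 1, inner ℝ (V (x + t • h) - V x) h := by
          simp_rw [inner_sub_left]
          rw [integral_sub (hi.inner_const h) (integrable_const _), hx]
          simp
        rw [h1]
        refine (enorm_integral_le_lintegral_enorm _).trans (lintegral_mono fun t => ?_)
        rw [mul_comm]
        rw [← ofReal_norm, ← ofReal_norm, ← ofReal_norm, ← ENNReal.ofReal_mul (norm_nonneg _)]
        exact ENNReal.ofReal_le_ofReal (norm_inner_le_norm _ _)
    _ = ∫⁻ t in Ioc (0 : ℝ) 1, ∫⁻ x, ‖h‖ₑ * ‖V (x + t • h) - V x‖ₑ :=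
        (lintegral_lintegral_swap (f := fun t x => ‖h‖ₑ * ‖V (x + t • h) - V x‖ₑ)
          (hdiff.1.enorm.const_mul _)).symm
    _ = _ := by
        rw [meanModulus, ← lintegral_const_mul' _ _ enorm_ne_top]
        simp_rw [lintegral_const_mul' _ _ enorm_ne_top]

theorem meanModulus_le (hV : Integrable V) (h : E) :
    meanModulus V h ≤ 2 * ∫⁻ x, ‖V x‖ₑ := by
  have h1 : ∀ k : E, ∫⁻ x, ‖V (x + k) - V x‖ₑ ≤ 2 * ∫⁻ x, ‖V x‖ₑ := fun k => by
    calc _ ≤ ∫⁻ x, (‖V (x + k)‖ₑ + ‖V x‖ₑ) := lintegral_mono fun x => enorm_sub_le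
      _ = _ := by
        rw [lintegral_add_right' _ hV.1.enorm, lintegral_add_right_eq_self (fun x => ‖V x‖ₑ),
          two_mul]
  refine (lintegral_mono fun t => h1 (t • h)).trans ?_
  simp

theorem tendsto_meanModulus (hV : Integrable V) : Tendsto (meanModulus V) (𝓝 0) (𝓝 0) := by
  rw [ENNReal.tendsto_nhds_zero]
  intro ε hε
  obtain ⟨δ, hδ, hb⟩ := Metric.eventually_nhds_iff.1
    (ENNReal.tendsto_nhds_zero.1 (tendsto_lintegral_enorm_translate_sub hV) ε hε)
  refine Metric.eventually_nhds_iff.2 ⟨δ, hδ, fun h hh => ?_⟩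
  calc meanModulus V h ≤ ∫⁻ _ in Ioc (0 : ℝ) 1, ε := by
        refine setLIntegral_mono measurable_const fun t ht => hb ?_
        rw [dist_zero_right] at hh ⊢
        rw [norm_smul, Real.norm_of_nonneg ht.1.le]
        exact (mul_le_of_le_one_left (norm_nonneg _) ht.2).trans_lt hh
    _ = ε := by simp

end Translation

/-- The Taylor defect of a function with an integrable weak gradient with respect to radial
mollifiers tends to zero. -/
theorem IsRadialMollifier.tendsto_taylorDefect {d : ℕ} [NeZero d] {ρ : ℕ → ℝ → ℝ}
    (hρ : IsRadialMollifier d ρ) {u : EuclideanSpace ℝ (Fin d) → ℝ}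
    {V : EuclideanSpace ℝ (Fin d) → EuclideanSpace ℝ (Fin d)} (hu : Integrable u)
    (hV : Integrable V) (h : HasWeakGradient u V) :
    Tendsto (fun n => taylorDefect (ρ n) u V) atTop (𝓝 0) := by
  have hw := (hasWeakGradient_iff_weakDefect hu hV).1 h
  refine tendsto_of_tendsto_of_tendsto_of_le_of_le tendsto_const_nhds
    (hρ.tendsto_lintegral_mul (ENNReal.mul_ne_top ENNReal.ofNat_ne_top hV.2.ne)
      (meanModulus_le hV) (tendsto_meanModulus hV)) (fun _ => bot_le) fun n => ?_
  simp only [taylorDefect_eq (hρ.aemeasurable n) hu hV]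
  refine lintegral_mono fun h => ?_
  gcongr
  calc ‖h‖ₑ⁻¹ * taylorRemainder u V h ≤ ‖h‖ₑ⁻¹ * (‖h‖ₑ * meanModulus V h) := by
        gcongr
        exact taylorRemainder_le hu hV hw h
    _ = ‖h‖ₑ⁻¹ * ‖h‖ₑ * meanModulus V h := (mul_assoc _ _ _).symm
    _ ≤ meanModulus V h := mul_le_of_le_one_left' (ENNReal.inv_mul_le_one _)

theorem mainTheorem5 (d : ℕ) (hd : 1 ≤ d) (ρ : ℕ → ℝ → ℝ) (hρ : IsRadialMollifier d ρ)
    (u : EuclideanSpace ℝ (Fin d) → ℝ) (hu : Integrable u volume) :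
    (MemW11 u ↔
      ∃ U : EuclideanSpace ℝ (Fin d) → EuclideanSpace ℝ (Fin d),
        Integrable U volume ∧ Tendsto (fun n => taylorDefect (ρ n) u U) atTop (𝓝 0)) ∧
    (∀ U : EuclideanSpace ℝ (Fin d) → EuclideanSpace ℝ (Fin d),
      Integrable U volume → Tendsto (fun n => taylorDefect (ρ n) u U) atTop (𝓝 0) →
        HasWeakGradient u U) := by
  have : NeZero d := ⟨Nat.one_le_iff_ne_zero.1 hd⟩
  refine ⟨⟨?_, ?_⟩, fun U hU h => hρ.hasWeakGradient hu hU h⟩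
  · rintro ⟨-, V, hV, h⟩
    exact ⟨V, hV, hρ.tendsto_taylorDefect hu hV h⟩
  · rintro ⟨U, hU, h⟩
    exact ⟨hu, U, hU, hρ.hasWeakGradient hu hU h⟩
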